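/- Let $p\ge 1$, $\alpha>0$, $\beta\in(0,1]$, $M>0$, and let $q\ge\alpha$ be an integer. \emph{Smoothness class.} Let $k$ be the largest integer strictly smaller than $\alpha$. $C^\alpha[0,1]$ is the space of functions $f$ on $[0,1]$ with $k$ continuous derivatives and finite Hölder norm $\|f\|_{C^\alpha}=\sum_{j\le k}\|f^{(j)}\|_\infty+\sup_{s\ne t}|f^{(k)}(s)-f^{(k)}(t)|/|s-t|^{\alpha-k}$, and $\mathcal{HC}^{\alpha,\beta}$ is the set of maps $\Xi:[0,1]^p\to C^\alpha[0,1]$ with $\sup_{\mathbf x\ne\mathbf x'}\|\Xi(\mathbf x)-\Xi(\mathbf x')\|_{C^\alpha}/\|\mathbf x-\mathbf x'\|_2^\beta<\infty$. We write $\Xi(t;\mathbf x)=\Xi(\mathbf x)(t)$. \emph{B-splines.} For $J\ge q$ let $\phi_1,\dots,\phi_J$ be the B-spline basis of order $q$ on $[0,1]$ given by the Cox--de Boor recursion for the knots $\xi_1=\dots=\xi_q=0$, $\xi_{q+i}=i/(J-q+1)$ for $0\le i\le J-q+1$, $\xi_{J+1}=\dots=\xi_{J+q}=1$, starting from the indicators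 of $[\xi_j,\xi_{j+1})$, where the last interval of positive length is closed at $1$. \emph{Trees.} A binary decision tree $\mathbf T$ whose internal nodes split by $\mathbf x(j)\le z$ versus $\mathbf x(j)>z$ partitions $[0,1]^p$ into cells $D^1,\dots,D^L$, one for each terminal node. With node parameters $\mathcal M=\{\boldsymbol\mu_1,\dots,\boldsymbol\mu_L\}\subset\mathbb R^J$ it defines $\Xi_{\mathbf T,\mathcal M}(t;\mathbf x)=\sum_{\ell=1}^L\mathbb I_{D^\ell}(\mathbf x)\sum_{j=1}^J\phi_j(t)\boldsymbol\mu_\ell(j)$. Given design points $\mathbf x_1,\dots,\mathbf x_n\in[0,1]^p$ and an ordering $\sigma$ of the $p$ variables, a \emph{k-d tree} is a binary decision tree such that (1) all terminal nodes have the same depth; (2) all internal nodes of the same depth split along the same variable, which cycles over the $p$ variables in the order $\sigma$; (3) the splitting value of each internal node is the median observed value in that node along the splitting variable, and it halves the observations: if the node contains $r\ge1$ observations, then $z$ is one of their values and $\lceil r/2\rceil$ of them go to the left child (nothing is required of $z$ at a node without observations). \emph{Regular design.} For a cell $D$ let $\mathrm{diam}(D)$ be the largest Euclidean distance of two design points in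 $D$ ($0$ if there are none). The design is \emph{regular with constant $M$} if for every $s\ge1$ the partition $\{D^1,\dots,D^L\}$ of a k-d tree with $L=2^{sp}$ terminal nodes satisfies $\max_\ell\mathrm{diam}(D^\ell)\le M\sum_{\ell=1}^L\frac{n_\ell}{n}\mathrm{diam}(D^\ell)$, where $n_\ell$ is the number of observations in $D^\ell$. \emph{Statement.} Let $\Xi_0\in\mathcal{HC}^{\alpha,\beta}$. There is a constant $C>0$, depending only on $p,\alpha,\beta,q,M$ and $\Xi_0$, such that the following holds for all $n\ge1$, all design points $\mathbf x_1,\dots,\mathbf x_n\in[0,1]^p$ and orderings $\sigma$ for which the design is regular with constant $M$, all $m_1,\dots,m_n\ge1$, all observation times $t_{ij}\in[0,1]$ ($1\le i\le n$, $1\le j\le m_i$), and all $J\ge q$. For any k-d tree $\mathbf T$ with $L$ terminal nodes there is a set of node parameters $\widehat{\mathcal M}$ such that $\widehat\Xi=\Xi_{\mathbf T,\widehat{\mathcal M}}$ satisfies $$d_n(\widehat\Xi,\Xi_0)\le C\,\bigl(J^{-\alpha}+L^{-\beta/p}\bigr),\qquad d_n^2(\Xi,\Xi')=\frac1{\sum_i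 m_i}\sum_{i=1}^n\sum_{j=1}^{m_i}\bigl(\Xi(t_{ij};\mathbf x_i)-\Xi'(t_{ij};\mathbf x_i)\bigr)^2 .$$ -/

import Mathlib

open Set
open scoped ENNReal NNReal

noncomputable section

namespace FBART

/-! ### Hölder spaces on the unit interval -/

/-- The number of derivatives in the Hölder space of order `α > 0`: the largest integer that is
strictly smaller than `α`. -/
def holderDeg (α : ℝ) : ℕ := ⌈α⌉₊ - 1

/-- The Hölder norm of order `α > 0` on `[0,1]`, with values in `[0,∞]`: with `k = holderDeg α`,
the sum of the sup norms of the derivatives of order `0, …, k` and of the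
`(α - k)`-Hölder seminorm of the `k`-th derivative. -/
def holderNorm (α : ℝ) (f : ℝ → ℝ) : ℝ≥0∞ :=
  (∑ j ∈ Finset.range (holderDeg α + 1),
      ⨆ t ∈ Icc (0 : ℝ) 1, ‖iteratedDerivWithin j f (Icc 0 1) t‖ₑ)
    + eHolderNorm (α - holderDeg α).toNNReal
        ((Icc (0 : ℝ) 1).domRestrict (iteratedDerivWithin (holderDeg α) f (Icc 0 1)))

/-- Membership in `C^α[0,1]`; only the values of `f` on `[0,1]` matter. -/
def MemC (α : ℝ) (f : ℝ → ℝ) : Prop :=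
  ContDiffOn ℝ (holderDeg α : ℕ) f (Icc 0 1) ∧ holderNorm α f < ∞

/-- The covariate space `[0,1]^p`. -/
def cube (p : ℕ) : Set (EuclideanSpace ℝ (Fin p)) := {x | ∀ j, x j ∈ Icc (0 : ℝ) 1}

/-- The class `HC^{α,β}` of maps `[0,1]^p → C^α[0,1]` that are `β`-Hölder with respect to the
Euclidean norm and the Hölder norm of order `α`; `Ξ x t` is only looked at for
`x ∈ [0,1]^p`, `t ∈ [0,1]`. -/
def MemHC {p : ℕ} (α β : ℝ) (Ξ : EuclideanSpace ℝ (Fin p) → ℝ → ℝ) : Prop :=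
  (∀ x ∈ cube p, MemC α (Ξ x)) ∧
    ∃ H : ℝ, ∀ x ∈ cube p, ∀ x' ∈ cube p,
      holderNorm α (fun t => Ξ x t - Ξ x' t) ≤ ENNReal.ofReal (H * ‖x - x'‖ ^ β)

/-! ### B-splines -/

/-- The knots `0 = … = 0 < 1/(J-q+1) < 2/(J-q+1) < … < 1 = … = 1` (each of the two boundary knots
has multiplicity `q`) of the B-spline basis of order `q` and dimension `J ≥ q` with equally spaced
knots. The index starts at `0`, so that the knots are `knot q J 0, …, knot q J (J + q - 1)`. -/
def knot (q J : ℕ) (j : ℕ) : ℝ :=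
  if j < q then 0 else if j < J then ((j : ℝ) + 1 - q) / ((J : ℝ) + 1 - q) else 1

/-- The B-spline of order `r` that starts at the knot `ξ j`, by the Cox–de Boor recursion. Terms
with a zero denominator are zero. The intervals of order one are half-open, except
that the last interval of positive length, the one that ends at `1`, contains its endpoint `1`. -/
def bspline (ξ : ℕ → ℝ) : (r : ℕ) → (j : ℕ) → ℝ → ℝ
  | 0, _, _ => 0
  | 1, j, t =>
      if (ξ j ≤ t ∧ t < ξ (j + 1)) ∨ (ξ j < ξ (j + 1) ∧ ξ (j + 1) = 1 ∧ t = 1) then 1 else 0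
  | r + 2, j, t =>
      (t - ξ j) / (ξ (j + r + 1) - ξ j) * bspline ξ (r + 1) j t
        + (ξ (j + r + 2) - t) / (ξ (j + r + 2) - ξ (j + 1)) * bspline ξ (r + 1) (j + 1) t

/-- The B-spline basis `φ_1, …, φ_J` of order `q` with equally spaced knots. -/
def basis (q J : ℕ) (j : Fin J) : ℝ → ℝ := bspline (knot q J) q j

/-! ### Binary decision trees -/

/-- A binary decision tree: an internal node sends `x` to the left child if `x j ≤ z` and to the
right child if `x j > z`. -/
inductive DTree (p : ℕ) : Type
  | leaf : DTree p
  | node (j : Fin p) (z : ℝ) (left right : DTree p) : DTree p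

/-- The terminal nodes of a tree. -/
def DTree.Leaf {p : ℕ} : DTree p → Type
  | .leaf => Unit
  | .node _ _ l r => l.Leaf ⊕ r.Leaf

instance DTree.instFintypeLeaf {p : ℕ} : (T : DTree p) → Fintype T.Leaf
  | .leaf => inferInstanceAs (Fintype Unit)
  | .node _ _ l r =>
      letI := DTree.instFintypeLeaf l
      letI := DTree.instFintypeLeaf r
      inferInstanceAs (Fintype (l.Leaf ⊕ r.Leaf))

/-- The cell of the induced partition of `[0,1]^p` that belongs to a terminal node. -/
def DTree.cell {p : ℕ} : (T : DTree p) → T.Leaf → Set (EuclideanSpace ℝ (Fin p))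
  | .leaf, _ => cube p
  | .node j z l _, .inl ℓ => {x | x j ≤ z} ∩ l.cell ℓ
  | .node j z _ r, .inr ℓ => {x | z < x j} ∩ r.cell ℓ

/-- The functional regression tree map with node parameters `μ`, evaluated at `x` and `t`. -/
def treeMap {p : ℕ} (q J : ℕ) (T : DTree p) (μ : T.Leaf → Fin J → ℝ)
    (x : EuclideanSpace ℝ (Fin p)) (t : ℝ) : ℝ :=
  ∑ ℓ : T.Leaf, (T.cell ℓ).indicator (fun _ => ∑ j : Fin J, basis q J j t * μ ℓ j) x

/-! ### k-d trees and regular designs -/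

/-- `z` is the median observed value of the `j`-th covariate among the observations in `A`, and
the split at `z` halves them: `⌈#A / 2⌉` of them go to the left. -/
def IsMedianSplit {p n : ℕ} (x : Fin n → EuclideanSpace ℝ (Fin p)) (A : Finset (Fin n))
    (j : Fin p) (z : ℝ) : Prop :=
  (∃ i ∈ A, x i j = z) ∧ (A.filter (fun i => x i j ≤ z)).card = (A.card + 1) / 2

/-- `T`, hanging at a node of depth `k` that contains the observations in `A`, has all its terminal
nodes `d` levels below that node, splits at the nodes of depth `k'` along the variable `var k'`,
and splits every node that contains an observation at the median. -/
def IsKDFrom {p n : ℕ} (x : Fin n → EuclideanSpace ℝ (Fin p)) (var : ℕ → Fin p) :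
    DTree p → Finset (Fin n) → (k d : ℕ) → Prop
  | .leaf, _, _, d => d = 0
  | .node _ _ _ _, _, _, 0 => False
  | .node j z l r, A, k, d + 1 =>
      j = var k ∧ (A.Nonempty → IsMedianSplit x A j z) ∧
        IsKDFrom x var l (A.filter (fun i => x i j ≤ z)) (k + 1) d ∧
        IsKDFrom x var r (A.filter (fun i => z < x i j)) (k + 1) d

/-- `T` is a k-d tree of depth `d` for the design `x`: the splitting variable cycles over the `p`
variables, in the order given by the permutation `σ`. -/
def IsKDTree {p n : ℕ} [NeZero p] (x : Fin n → EuclideanSpace ℝ (Fin p))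
    (σ : Equiv.Perm (Fin p)) (d : ℕ) (T : DTree p) : Prop :=
  IsKDFrom x (fun k => σ (Fin.ofNat p k)) T Finset.univ 0 d

/-- The diameter of the set of design points in `D` (zero if there are none). -/
def designDiam {p n : ℕ} (x : Fin n → EuclideanSpace ℝ (Fin p))
    (D : Set (EuclideanSpace ℝ (Fin p))) : ℝ :=
  Metric.diam (range x ∩ D)

/-- The number of observations whose design point is in `D`. -/
def designCount {p n : ℕ} (x : Fin n → EuclideanSpace ℝ (Fin p))
    (D : Set (EuclideanSpace ℝ (Fin p))) : ℕ :=
  Nat.card {i : Fin n // x i ∈ D}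

/-- The design is regular with constant `M`: for every `s ≥ 1`, in the partition of a k-d tree after
`s` rounds of splitting cycles the largest diameter is at most `M` times the
average diameter, weighted by the proportions of observations. -/
def RegularDesign {p n : ℕ} [NeZero p] (x : Fin n → EuclideanSpace ℝ (Fin p))
    (σ : Equiv.Perm (Fin p)) (M : ℝ) : Prop :=
  ∀ s : ℕ, 1 ≤ s → ∀ T : DTree p, IsKDTree x σ (s * p) T → ∀ ℓ : T.Leaf,
    designDiam x (T.cell ℓ) ≤
      M * ∑ ℓ' : T.Leaf, (designCount x (T.cell ℓ') : ℝ) / n * designDiam x (T.cell ℓ')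

/-- The empirical distance `d_n` of two regression maps: `m i` is the number of
observation times `t i 0, t i 1, …` of subject `i`. -/
def empDist {p n : ℕ} (x : Fin n → EuclideanSpace ℝ (Fin p)) (m : Fin n → ℕ)
    (t : (i : Fin n) → Fin (m i) → ℝ) (Ξ Ξ' : EuclideanSpace ℝ (Fin p) → ℝ → ℝ) : ℝ :=
  Real.sqrt ((∑ i, ∑ j, (Ξ (x i) (t i j) - Ξ' (x i) (t i j)) ^ 2) / ((∑ i, m i : ℕ) : ℝ))

end FBART

end

/-!
The error of a tree map splits into a spline error in `t` and a discretization error in `x`. For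
each cell that contains a design point, fix one, `x₀` say, and let the node parameters be the
coefficients of a spline close to `Ξ₀ x₀`. At another design point `x` of the cell the error is
at most the spline error plus `‖Ξ₀ x₀ - Ξ₀ x‖_∞ ≤ H * diam ^ β`, where `diam` is the design diameter
of the cell.

*Splines.* By Marsden's identity (`marsden`) the B-splines reproduce polynomials of degree less
than `q`, the coefficient of a polynomial at a spline being its polar form at the interior knots
(`blossom`, `sum_bspline_mul_blossom`). The quasi-interpolant of `f` gives to each B-spline the polar
form of the Taylor polynomial of `f` at the left end `τ` of its support. At `t` the value `f t` is
reproduced by the Taylor polynomial at `t`, so the error is a convex combination of polar forms of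
differences of Taylor polynomials at `τ` and `t`. Expanded about `t`, the `s`-th coefficient of such a
difference is a Taylor remainder of the `s`-th derivative, of size `|t - τ| ^ (α - s)`
(`abs_taylor_sub_le`), and the polar form of `(X - t) ^ s` is at most the `s`-th power of the
support length (`abs_blossom_le`). All terms are thus of order `J ^ (-α)`
(`exists_spline_approx`). The constant involves `f` only through the Hölder seminorm of its last
derivative, which is bounded uniformly over `Ξ₀ x` (`MemHC.exists_uniform_holder`).

*Cells.* In a k-d tree of depth `s * p` each split halves the counts, so that a cell has a proportion
of order `2 ^ (-s * p)` of the observations (`IsKDFrom.card_cellObs_le`). A split along the `j`-th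
variable does not increase the sum over the cells of their widths along that variable, and the
other splits at most double it (`IsKDFrom.sum_width_le`), so this sum is at most `2 ^ (s * (p - 1))`.
Hence the average diameter is of order `2 ^ (-s)`, and by regularity so is the largest
(`RegularDesign.designDiam_le_of_rounds`). Truncation to a multiple of `p` levels handles the other
depths, and gives diameters of order `L ^ (-1 / p)` (`RegularDesign.designDiam_le`).
-/

namespace FBART

section Splines

open Polynomial

/-! ### B-splines: support, positivity and Marsden's identity -/

theorem bspline_support {ξ : ℕ → ℝ} (hξ : Monotone ξ) {t : ℝ} :
    ∀ {r j : ℕ}, bspline ξ r j t ≠ 0 → ξ j ≤ t ∧ t ≤ ξ (j + r) ∧ ξ j < ξ (j + r)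
  | 0, j, h => by simp [bspline] at h
  | 1, j, h => by
      simp only [bspline] at h
      split_ifs at h with h'
      · rcases h' with h' | ⟨h1, h2, h3⟩
        · exact ⟨h'.1, h'.2.le, h'.1.trans_lt h'.2⟩
        · exact ⟨by linarith, by linarith, h1⟩
      · exact absurd rfl h
  | r + 2, j, h => by
      have h1 : ξ j ≤ ξ (j + 1) := hξ (by omega)
      have h2 : ξ (j + (r + 1)) ≤ ξ (j + (r + 2)) := hξ (by omega)
      by_cases hl : bspline ξ (r + 1) j t = 0
      · have hr : bspline ξ (r + 1) (j + 1) t ≠ 0 := by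
          intro hr
          simp [bspline, hl, hr] at h
        obtain ⟨a, b, c⟩ := bspline_support hξ hr
        rw [show j + 1 + (r + 1) = j + (r + 2) by ring] at b c
        exact ⟨h1.trans a, b, h1.trans_lt c⟩
      · obtain ⟨a, b, c⟩ := bspline_support hξ hl
        exact ⟨a, b.trans h2, c.trans_le h2⟩

theorem bspline_nonneg {ξ : ℕ → ℝ} (hξ : Monotone ξ) (t : ℝ) :
    ∀ r j : ℕ, 0 ≤ bspline ξ r j t
  | 0, j => by simp [bspline]
  | 1, j => by
      simp only [bspline]
      split_ifs <;> norm_num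
  | r + 2, j => by
      simp only [bspline]
      refine add_nonneg ?_ ?_
      · by_cases hl : bspline ξ (r + 1) j t = 0
        · simp [hl]
        · obtain ⟨a, b, c⟩ := bspline_support hξ hl
          exact mul_nonneg (div_nonneg (by linarith) (by rw [add_assoc]; linarith))
            (bspline_nonneg hξ t (r + 1) j)
      · by_cases hr : bspline ξ (r + 1) (j + 1) t = 0
        · simp [hr]
        · obtain ⟨a, b, c⟩ := bspline_support hξ hr
          rw [show j + 1 + (r + 1) = j + r + 2 by ring] at b c
          exact mul_nonneg (div_nonneg (by linarith) (by linarith))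
            (bspline_nonneg hξ t (r + 1) (j + 1))

/-- The splines of order one sum to `1`: each is the difference of the values of a monotone
indicator at consecutive knots, so the sum telescopes. -/
theorem sum_bspline_one {ξ : ℕ → ℝ} (hξ : Monotone ξ) {J : ℕ} (h0 : ξ 0 = 0)
    (h1 : ∀ j, J ≤ j → ξ j = 1) {t : ℝ} (ht : t ∈ Icc (0 : ℝ) 1) :
    ∑ j ∈ Finset.range J, bspline ξ 1 j t = 1 := by
  have hle : ∀ j, ξ j ≤ 1 := fun j => by
    rw [← h1 (max J j) (le_max_left _ _)]
    exact hξ (le_max_right _ _)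
  rcases ht.2.lt_or_eq with h | h
  · have key : ∀ j, bspline ξ 1 j t
        = (if t < ξ (j + 1) then 1 else 0) - (if t < ξ j then 1 else 0) := by
      intro j
      have := hξ (Nat.le_succ j)
      simp only [Nat.succ_eq_add_one] at this
      simp only [bspline, h.ne, and_false, or_false]
      by_cases a : t < ξ (j + 1)
      · by_cases b : t < ξ j
        · simp [a, b]
        · simp [a, b, not_lt.mp b]
      · have b : ¬ t < ξ j := fun b => a (b.trans_le this)
        simp [a, b]
    rw [Finset.sum_congr rfl fun j _ => key j,
      Finset.sum_range_sub (fun j => if t < ξ j then (1 : ℝ) else 0) J]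
    simp [h0, h1 J le_rfl, h, ht.1]
  · subst h
    have key : ∀ j, bspline ξ 1 j 1
        = (if ξ (j + 1) = 1 then 1 else 0) - (if ξ j = 1 then 1 else 0) := by
      intro j
      have hm := hξ (Nat.le_succ j)
      simp only [Nat.succ_eq_add_one] at hm
      have hn : ¬ (1 : ℝ) < ξ (j + 1) := not_lt.mpr (hle _)
      simp only [bspline, hn, and_false, false_or, and_true]
      by_cases a : ξ (j + 1) = 1
      · by_cases b : ξ j = 1
        · simp [a, b]
        · simp [a, b, lt_of_le_of_ne (hle j) b]
      · have b : ξ j ≠ 1 := fun b => a (le_antisymm (hle _) (b ▸ hm))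
        simp [a, b]
    rw [Finset.sum_congr rfl fun j _ => key j,
      Finset.sum_range_sub (fun j => if ξ j = 1 then (1 : ℝ) else 0) J]
    simp [h0, h1 J le_rfl]

/-- Marsden's identity, with the dual polynomials written as products over the interior knots of
each spline. -/
theorem marsden {ξ : ℕ → ℝ} (hξ : Monotone ξ) {q J : ℕ} (h0 : ∀ j, j < q → ξ j = 0)
    (h1 : ∀ j, J ≤ j → ξ j = 1) {t : ℝ} (ht : t ∈ Icc (0 : ℝ) 1) (u : ℝ) :
    ∀ r : ℕ, r < q →
      ∑ j ∈ Finset.range J, bspline ξ (r + 1) j t * ∏ i ∈ Finset.range r, (ξ (j + 1 + i) + u)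
        = (t + u) ^ r
  | 0, hr => by simpa using sum_bspline_one hξ (h0 0 hr) h1 ht
  | r + 1, hr => by
      have hzero : ∀ j, ξ j = ξ (j + (r + 1)) → bspline ξ (r + 1) j t = 0 := by
        intro j hj
        by_contra hne
        exact (bspline_support hξ hne).2.2.ne hj
      have hB0 : bspline ξ (r + 1) 0 t = 0 :=
        hzero 0 (by rw [h0 0 (by omega), h0 _ (by omega)])
      have hBJ : bspline ξ (r + 1) J t = 0 :=
        hzero J (by rw [h1 J le_rfl, h1 _ (by omega)])
      -- The contribution of a lower order spline as the right-hand summand of the recursion.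
      set G : ℕ → ℝ := fun j =>
        (ξ (j + r + 1) - t) / (ξ (j + r + 1) - ξ j) * bspline ξ (r + 1) j t
          * ((ξ j + u) * ∏ i ∈ Finset.range r, (ξ (j + 1 + i) + u)) with hG
      have hGsum : ∑ j ∈ Finset.range J, G (j + 1) = ∑ j ∈ Finset.range J, G j := by
        have e1 := Finset.sum_range_succ G J
        have e2 := Finset.sum_range_succ' G J
        have g0 : G 0 = 0 := by simp [hG, hB0]
        have gJ : G J = 0 := by simp [hG, hBJ]
        linarith
      have hstep : ∀ j, bspline ξ (r + 1 + 1) j t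
            * ∏ i ∈ Finset.range (r + 1), (ξ (j + 1 + i) + u)
          = (t - ξ j) / (ξ (j + r + 1) - ξ j) * bspline ξ (r + 1) j t
            * ((∏ i ∈ Finset.range r, (ξ (j + 1 + i) + u)) * (ξ (j + r + 1) + u))
            + G (j + 1) := by
        intro j
        simp only [hG, bspline]
        rw [add_mul, Finset.prod_range_succ, show j + 1 + r = j + r + 1 by ring]
        congr 1
        rw [show j + r + 2 = j + 1 + r + 1 by ring, mul_assoc, mul_assoc,
          ← show j + 1 + r = j + r + 1 by ring,
          ← Finset.prod_range_succ (fun i => ξ (j + 1 + i) + u),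
          Finset.prod_range_succ']
        have : ∏ i ∈ Finset.range r, (ξ (j + 1 + (i + 1)) + u)
            = ∏ i ∈ Finset.range r, (ξ (j + 1 + 1 + i) + u) :=
          Finset.prod_congr rfl fun i _ => by
            rw [show j + 1 + (i + 1) = j + 1 + 1 + i by ring]
        rw [this, add_zero]
        ring
      rw [Finset.sum_congr rfl fun j _ => hstep j, Finset.sum_add_distrib, hGsum,
        ← Finset.sum_add_distrib, pow_succ, ← marsden hξ h0 h1 ht u r (by omega),
        Finset.sum_mul]
      refine Finset.sum_congr rfl fun j _ => ?_
      simp only [hG]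
      by_cases hj : ξ j = ξ (j + r + 1)
      · rw [hzero j hj]; simp
      · have : ξ (j + r + 1) - ξ j ≠ 0 := sub_ne_zero.mpr (Ne.symm hj)
        field_simp
        ring

/-! ### The polar form of a polynomial -/

/-- The polar form (blossom) of degree `n` of a polynomial of degree at most `n`, evaluated at
`a 0, …, a (n - 1)`. It sends `X ^ r` to the `r`-th elementary symmetric function of the `a i`
divided by `n.choose r`, the former being read off the coefficients of `∏ i, (X + a i)`. -/
noncomputable def blossom (n : ℕ) (a : ℕ → ℝ) : ℝ[X] →ₗ[ℝ] ℝ :=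
  ∑ r ∈ Finset.range (n + 1),
    ((∏ i ∈ Finset.range n, (X + C (a i))).coeff (n - r) / (n.choose r : ℝ)) • lcoeff ℝ r

theorem natDegree_prod_X_add_C (n : ℕ) (a : ℕ → ℝ) :
    (∏ i ∈ Finset.range n, (X + C (a i))).natDegree = n := by
  rw [natDegree_prod_of_monic _ _ fun i _ => monic_X_add_C (a i)]
  simp

theorem blossom_X_add_C_pow_self (n : ℕ) (a : ℕ → ℝ) (u : ℝ) :
    blossom n a ((X + C u) ^ n) = ∏ i ∈ Finset.range n, (a i + u) := by
  have h : ∏ i ∈ Finset.range n, (a i + u)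
      = (∏ i ∈ Finset.range n, (X + C (a i))).eval u := by
    simp [eval_prod, add_comm]
  rw [h, eval_eq_sum_range, natDegree_prod_X_add_C, ← Finset.sum_range_reflect]
  simp only [blossom, LinearMap.sum_apply, LinearMap.smul_apply, lcoeff_apply, smul_eq_mul,
    coeff_X_add_C_pow]
  refine Finset.sum_congr rfl fun r hr => ?_
  have hc : (n.choose r : ℝ) ≠ 0 :=
    Nat.cast_ne_zero.mpr (Nat.choose_pos (Nat.lt_succ_iff.mp (Finset.mem_range.mp hr))).ne'
  rw [show n + 1 - 1 - r = n - r by omega]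
  field_simp

/-- Comparison of the coefficients in `u` of the polar form of `(X + b + u) ^ n`. -/
theorem choose_mul_blossom (n : ℕ) (a : ℕ → ℝ) (b : ℝ) {r : ℕ} (hr : r ≤ n) :
    (n.choose r : ℝ) * blossom n a ((X + C b) ^ r)
      = (∏ i ∈ Finset.range n, (X + C (a i + b))).coeff (n - r) := by
  have key : ∑ r ∈ Finset.range (n + 1),
      C ((n.choose r : ℝ) * blossom n a ((X + C b) ^ r)) * X ^ (n - r)
        = ∏ i ∈ Finset.range n, (X + C (a i + b)) := by
    refine Polynomial.funext fun u => ?_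
    have h := blossom_X_add_C_pow_self n a (b + u)
    rw [C_add, ← add_assoc, add_pow, map_sum] at h
    rw [eval_finsetSum, eval_prod]
    convert h using 2 with r _ i _
    · rw [show (X + C b) ^ r * C u ^ (n - r) * ((n.choose r : ℕ) : ℝ[X])
          = ((n.choose r : ℝ) * u ^ (n - r)) • (X + C b) ^ r by
        rw [smul_eq_C_mul, C_mul, C_pow, ← C_eq_natCast]; simp; ring, map_smul]
      simp; ring
    · simp; ring
  rw [← key, finsetSum_coeff, Finset.sum_eq_single r]
  · rw [coeff_C_mul, coeff_X_pow, if_pos rfl, mul_one]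
  · intro s hs hsr
    have := Finset.mem_range.mp hs
    rw [coeff_C_mul, coeff_X_pow, if_neg (by omega), mul_zero]
  · intro h
    exact absurd (Finset.mem_range.mpr (by omega)) h

theorem abs_coeff_prod_X_add_C_le {δ : ℝ} (hδ : 0 ≤ δ) (a : ℕ → ℝ) :
    ∀ n : ℕ, (∀ i < n, |a i| ≤ δ) → ∀ r ≤ n,
      |(∏ i ∈ Finset.range n, (X + C (a i))).coeff (n - r)| ≤ n.choose r * δ ^ r
  | 0, _, r, hr => by
      obtain rfl : r = 0 := by omega
      simp
  | n + 1, h, 0, _ => by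
      have hm : (∏ i ∈ Finset.range (n + 1), (X + C (a i))).Monic :=
        monic_prod_of_monic _ _ fun i _ => monic_X_add_C (a i)
      have := hm.coeff_natDegree
      rw [natDegree_prod_X_add_C] at this
      simp [this]
  | n + 1, h, r + 1, hr => by
      have ih := abs_coeff_prod_X_add_C_le hδ a n fun i hi => h i (by omega)
      have h1 := ih r (by omega)
      rw [Finset.prod_range_succ, mul_add, coeff_add, coeff_mul_C]
      have h2 : |(∏ i ∈ Finset.range n, (X + C (a i))).coeff (n - r) * a n|
          ≤ n.choose r * δ ^ (r + 1) := by
        rw [abs_mul, pow_succ, ← mul_assoc]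
        exact mul_le_mul h1 (h n (by omega)) (abs_nonneg _) (by positivity)
      have h3 : |((∏ i ∈ Finset.range n, (X + C (a i))) * X).coeff (n - r)|
          ≤ n.choose (r + 1) * δ ^ (r + 1) := by
        rcases (by omega : n = r ∨ r + 1 ≤ n) with rfl | hlt
        · simp
        · rw [show n - r = n - (r + 1) + 1 by omega, coeff_mul_X]
          exact ih (r + 1) hlt
      rw [show n + 1 - (r + 1) = n - r by omega, Nat.choose_succ_succ]
      push_cast
      calc _ ≤ _ := abs_add_le _ _
        _ ≤ _ := add_le_add h3 h2
        _ = _ := by ring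

theorem abs_blossom_le {δ : ℝ} (hδ : 0 ≤ δ) {n : ℕ} {a : ℕ → ℝ} {t : ℝ}
    (h : ∀ i < n, |a i - t| ≤ δ) {r : ℕ} (hr : r ≤ n) :
    |blossom n a ((X - C t) ^ r)| ≤ δ ^ r := by
  have hc : (0 : ℝ) < n.choose r := Nat.cast_pos.mpr (Nat.choose_pos hr)
  have h1 := abs_coeff_prod_X_add_C_le hδ (fun i => a i + -t) n
    (by simpa [sub_eq_add_neg] using h) r hr
  rw [← choose_mul_blossom n a (-t) hr, abs_mul, abs_of_pos hc, C_neg, ← sub_eq_add_neg] at h1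
  exact le_of_mul_le_mul_left h1 hc

/-- Splines of order `n + 1` reproduce polynomials of degree at most `n`: the coefficients are
the polar forms at the interior knots. -/
theorem sum_bspline_mul_blossom {ξ : ℕ → ℝ} (hξ : Monotone ξ) {n J : ℕ}
    (h0 : ∀ j, j < n + 1 → ξ j = 0) (h1 : ∀ j, J ≤ j → ξ j = 1) {t : ℝ}
    (ht : t ∈ Icc (0 : ℝ) 1) (b : ℝ) {r : ℕ} (hr : r ≤ n) :
    ∑ j ∈ Finset.range J,
        bspline ξ (n + 1) j t * blossom n (fun i => ξ (j + 1 + i)) ((X - C b) ^ r)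
      = (t - b) ^ r := by
  have hc : (n.choose r : ℝ) ≠ 0 := Nat.cast_ne_zero.mpr (Nat.choose_pos hr).ne'
  have key : ∑ j ∈ Finset.range J,
      C (bspline ξ (n + 1) j t) * ∏ i ∈ Finset.range n, (X + C (ξ (j + 1 + i) + -b))
        = (X + C (t + -b)) ^ n := by
    refine Polynomial.funext fun u => ?_
    have h := marsden hξ h0 h1 ht (-b + u) n (by omega)
    rw [eval_finsetSum]
    simp only [eval_mul, eval_prod, eval_add, eval_X, eval_C, eval_pow]
    have e : ∀ j i, u + (ξ (j + 1 + i) + -b) = ξ (j + 1 + i) + (-b + u) := fun j i => by ring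
    simp only [e, h]
    ring
  have hcoeff : ∀ j, (∏ i ∈ Finset.range n, (X + C (ξ (j + 1 + i) + -b))).coeff (n - r)
      = n.choose r * blossom n (fun i => ξ (j + 1 + i)) ((X - C b) ^ r) := fun j => by
    rw [sub_eq_add_neg, ← C_neg]
    exact (choose_mul_blossom n (fun i => ξ (j + 1 + i)) (-b) hr).symm
  have := congrArg (fun P => P.coeff (n - r)) key
  simp only [finsetSum_coeff, coeff_C_mul, hcoeff, coeff_X_add_C_pow, Nat.choose_symm hr] at this
  rw [show n - (n - r) = r by omega, ← sub_eq_add_neg] at this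
  apply mul_left_cancel₀ hc
  rw [mul_comm _ ((t - b) ^ r), ← this, Finset.mul_sum]
  exact Finset.sum_congr rfl fun j _ => by ring

theorem blossom_translate (n : ℕ) (a : ℕ → ℝ) (τ t : ℝ) (r : ℕ) :
    blossom n a ((X - C τ) ^ r)
      = ∑ s ∈ Finset.range (r + 1),
          r.choose s * (t - τ) ^ (r - s) * blossom n a ((X - C t) ^ s) := by
  have : (X - C τ : ℝ[X]) = (X - C t) + C (t - τ) := by simp
  rw [this, add_pow, map_sum]
  refine Finset.sum_congr rfl fun s _ => ?_
  rw [show (X - C t) ^ s * C (t - τ) ^ (r - s) * ((r.choose s : ℕ) : ℝ[X])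
      = ((r.choose s : ℝ) * (t - τ) ^ (r - s)) • (X - C t) ^ s by
    rw [smul_eq_C_mul, C_mul, C_pow, ← C_eq_natCast]; simp; ring, map_smul, smul_eq_mul]

/-! ### Taylor expansion in a Hölder class -/

/-- Taylor's formula with a Hölder remainder, for a chain `g 0, …, g k` of successive derivatives
whose last member is `γ`-Hölder. The derivative of the remainder is the remainder of the shifted
chain, so the mean value inequality gains one power at each step. -/
theorem abs_taylor_sub_le {γ K : ℝ} (hγ : 0 < γ) (hK : 0 ≤ K) {τ : ℝ} (hτ : τ ∈ Icc (0 : ℝ) 1) :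
    ∀ (k : ℕ) (g : ℕ → ℝ → ℝ),
      (∀ r < k, ∀ t ∈ Icc (0 : ℝ) 1, HasDerivWithinAt (g r) (g (r + 1) t) (Icc 0 1) t) →
      (∀ s ∈ Icc (0 : ℝ) 1, ∀ t ∈ Icc (0 : ℝ) 1, |g k s - g k t| ≤ K * |s - t| ^ γ) →
      ∀ t ∈ Icc (0 : ℝ) 1,
        |∑ s ∈ Finset.range (k + 1), g s τ * (t - τ) ^ s / s.factorial - g 0 t|
          ≤ K * |t - τ| ^ (γ + k)
  | 0, g, _, hH, t, ht => by
      simpa [abs_sub_comm t τ] using hH τ hτ t ht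
  | k + 1, g, hd, hH, t, ht => by
      have ih := abs_taylor_sub_le hγ hK hτ k (fun r => g (r + 1))
        (fun r hr => hd (r + 1) (by omega)) hH
      have hsub : uIcc τ t ⊆ Icc (0 : ℝ) 1 := uIcc_subset_Icc hτ ht
      have hder : ∀ y ∈ uIcc τ t, HasDerivWithinAt
          (fun y => ∑ s ∈ Finset.range (k + 1 + 1), g s τ * (y - τ) ^ s / s.factorial - g 0 y)
          (∑ s ∈ Finset.range (k + 1), g (s + 1) τ * (y - τ) ^ s / s.factorial - g 1 y)
          (uIcc τ t) y := by
        intro y hy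
        refine HasDerivWithinAt.sub ?_ ((hd 0 (by omega) y (hsub hy)).mono hsub)
        simp only [Finset.sum_range_succ' _ (k + 1), pow_zero]
        refine HasDerivWithinAt.add_const _ (HasDerivWithinAt.fun_sum fun s _ => ?_)
        have h := (((hasDerivAt_id y).sub_const τ).pow (s + 1)).const_mul (g (s + 1) τ)
        have h' := (h.div_const ((s + 1).factorial : ℝ)).hasDerivWithinAt (s := uIcc τ t)
        refine HasDerivWithinAt.congr_deriv h' ?_
        have : (s.factorial : ℝ) ≠ 0 := by positivity
        rw [Nat.factorial_succ, Nat.add_sub_cancel, id, Nat.cast_mul]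
        field_simp
      have hbd : ∀ y ∈ uIcc τ t,
          ‖∑ s ∈ Finset.range (k + 1), g (s + 1) τ * (y - τ) ^ s / s.factorial - g 1 y‖
            ≤ K * |t - τ| ^ (γ + k) := by
        intro y hy
        refine (ih y (hsub hy)).trans ?_
        have : |y - τ| ≤ |t - τ| := abs_sub_left_of_mem_uIcc hy
        gcongr
      have h := Convex.norm_image_sub_le_of_norm_hasDerivWithin_le hder hbd
        (convex_uIcc τ t) left_mem_uIcc right_mem_uIcc
      have h0 : ∑ s ∈ Finset.range (k + 1 + 1), g s τ * (τ - τ) ^ s / s.factorial - g 0 τ = 0 := by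
        rw [Finset.sum_range_succ']
        simp
      rw [h0, sub_zero, Real.norm_eq_abs, Real.norm_eq_abs] at h
      refine h.trans (le_of_eq ?_)
      push_cast
      rw [← add_assoc, Real.rpow_add_one' (abs_nonneg _) (by positivity), mul_assoc]

theorem holderDeg_lt {α : ℝ} (hα : 0 < α) : (holderDeg α : ℝ) < α := by
  have h1 : 0 < ⌈α⌉₊ := Nat.ceil_pos.mpr hα
  have h2 := Nat.ceil_lt_add_one hα.le
  rw [holderDeg, Nat.cast_sub (by omega)]
  push_cast
  linarith

theorem holderDeg_lt_of_le {α : ℝ} (hα : 0 < α) {q : ℕ} (hq : α ≤ q) : holderDeg α < q := by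
  have h1 : 0 < ⌈α⌉₊ := Nat.ceil_pos.mpr hα
  have h2 : ⌈α⌉₊ ≤ q := Nat.ceil_le.mpr hq
  rw [holderDeg]
  omega

theorem hasDerivWithinAt_iteratedDerivWithin {k r : ℕ} (hr : r < k) {f : ℝ → ℝ}
    (hf : ContDiffOn ℝ k f (Icc 0 1)) {t : ℝ} (ht : t ∈ Icc (0 : ℝ) 1) :
    HasDerivWithinAt (iteratedDerivWithin r f (Icc 0 1))
      (iteratedDerivWithin (r + 1) f (Icc 0 1) t) (Icc 0 1) t := by
  rw [iteratedDerivWithin_succ]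
  exact (hf.differentiableOn_iteratedDerivWithin (by exact_mod_cast hr)
    (uniqueDiffOn_Icc zero_lt_one) t ht).hasDerivWithinAt

/-! ### Spline approximation of Hölder functions -/

theorem knot_of_lt {q J j : ℕ} (h : j < q) : knot q J j = 0 := by simp [knot, h]

theorem knot_of_le {q J j : ℕ} (hqJ : q ≤ J) (h : J ≤ j) : knot q J j = 1 := by
  rw [knot, if_neg (by omega), if_neg (by omega)]

theorem knot_succ_sub_mem {q J : ℕ} (hqJ : q ≤ J) (j : ℕ) :
    0 ≤ knot q J (j + 1) - knot q J j ∧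
      knot q J (j + 1) - knot q J j ≤ 1 / ((J : ℝ) + 1 - q) := by
  have hqJ' : (q : ℝ) ≤ J := Nat.cast_le.mpr hqJ
  have hpos : (0 : ℝ) < (J : ℝ) + 1 - q := by linarith
  have hinv : 0 ≤ 1 / ((J : ℝ) + 1 - q) := by positivity
  rcases lt_trichotomy (j + 1) q with h | h | h
  · rw [knot_of_lt h, knot_of_lt (by omega)]
    simpa using hinv
  · rw [knot_of_lt (by omega : j < q)]
    rcases hqJ.lt_or_eq with h' | h'
    · rw [knot, if_neg (by omega), if_pos (by omega), h]
      simpa using hinv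
    · rw [knot_of_le hqJ (by omega), h']
      simp
  · rcases lt_trichotomy (j + 1) J with h' | h' | h'
    · rw [knot, if_neg (by omega), if_pos h', knot, if_neg (by omega), if_pos (by omega),
        ← sub_div]
      push_cast
      rw [show (j : ℝ) + 1 + 1 - q - (j + 1 - q) = 1 by ring]
      exact ⟨hinv, le_rfl⟩
    · rw [knot_of_le hqJ h'.ge, knot, if_neg (by omega), if_pos (by omega)]
      have : (J : ℝ) = j + 1 := by rw [← h']; push_cast; ring
      rw [this] at hpos ⊢
      rw [one_sub_div hpos.ne', show (j : ℝ) + 1 + 1 - q - (j + 1 - q) = 1 by ring]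
      exact ⟨by positivity, le_rfl⟩
    · rw [knot_of_le hqJ (by omega), knot_of_le hqJ (by omega)]
      simpa using hinv

theorem knot_mono {q J : ℕ} (hqJ : q ≤ J) : Monotone (knot q J) :=
  monotone_nat_of_le_succ fun j => sub_nonneg.mp (knot_succ_sub_mem hqJ j).1

theorem knot_mem_Icc {q J : ℕ} (hq : 0 < q) (hqJ : q ≤ J) (j : ℕ) :
    knot q J j ∈ Icc (0 : ℝ) 1 := by
  constructor
  · rw [← knot_of_lt (J := J) hq]
    exact knot_mono hqJ (Nat.zero_le j)
  · rw [← knot_of_le hqJ (le_max_left J j)]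
    exact knot_mono hqJ (le_max_right J j)

/-- The support of a B-spline of order `q` has length at most `q ^ 2 / J`. -/
theorem knot_add_sub_le {q J : ℕ} (hq : 0 < q) (hqJ : q ≤ J) (j : ℕ) :
    knot q J (j + q) - knot q J j ≤ (q : ℝ) ^ 2 / J := by
  have hqJ' : (q : ℝ) ≤ J := Nat.cast_le.mpr hqJ
  have hq' : (1 : ℝ) ≤ q := Nat.one_le_cast.mpr hq
  have h : ∀ r : ℕ, knot q J (j + r) - knot q J j ≤ r * (1 / ((J : ℝ) + 1 - q)) := by
    intro r
    induction r with
    | zero => simp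
    | succ r ih =>
      have := (knot_succ_sub_mem hqJ (j + r)).2
      rw [← add_assoc]
      push_cast
      linarith
  refine (h q).trans ?_
  rw [mul_one_div, div_le_div_iff₀ (by linarith) (by linarith)]
  -- `J ≤ q * (J + 1 - q)` is `0 ≤ (q - 1) * (J - q)`.
  have : (J : ℝ) ≤ q * (J + 1 - q) := by
    nlinarith [mul_nonneg (sub_nonneg.2 hq') (sub_nonneg.2 hqJ')]
  nlinarith

/-- Expansion about `t` of a quasi-interpolation coefficient that is defined by expansion
about `τ`: the sum over `r` becomes a sum of Taylor polynomials of the derivatives. -/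
theorem sum_blossom_eq (n k : ℕ) (a b : ℕ → ℝ) (τ t : ℝ) :
    ∑ r ∈ Finset.range (k + 1), b r / r.factorial * blossom n a ((X - C τ) ^ r)
      = ∑ s ∈ Finset.range (k + 1), blossom n a ((X - C t) ^ s) / s.factorial *
          ∑ u ∈ Finset.range (k - s + 1), b (s + u) * (t - τ) ^ u / u.factorial := by
  have h := Finset.sum_range_diag_flip (k + 1) (fun s u =>
    b (s + u) / (s + u).factorial *
      ((s + u).choose s * (t - τ) ^ u * blossom n a ((X - C t) ^ s)))
  have e1 : ∀ r ∈ Finset.range (k + 1), b r / r.factorial * blossom n a ((X - C τ) ^ r)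
      = ∑ s ∈ Finset.range (r + 1), b (s + (r - s)) / (s + (r - s)).factorial *
        ((s + (r - s)).choose s * (t - τ) ^ (r - s) * blossom n a ((X - C t) ^ s)) := by
    intro r _
    rw [blossom_translate n a τ t r, Finset.mul_sum]
    refine Finset.sum_congr rfl fun s hs => ?_
    have := Finset.mem_range.mp hs
    rw [show s + (r - s) = r by omega]
  rw [Finset.sum_congr rfl e1, h]
  refine Finset.sum_congr rfl fun s hs => ?_
  have := Finset.mem_range.mp hs
  rw [show k + 1 - s = k - s + 1 by omega, Finset.mul_sum]
  refine Finset.sum_congr rfl fun u _ => ?_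
  have h1 : ((s + u).factorial : ℝ) = (s + u).choose s * s.factorial * u.factorial := by
    rw [← Nat.add_choose_mul_factorial_mul_factorial s u, Nat.choose_symm_add]
    push_cast
    ring
  have h2 : ((s + u).choose s : ℝ) ≠ 0 :=
    Nat.cast_ne_zero.mpr (Nat.choose_pos (Nat.le_add_right _ _)).ne'
  rw [h1]
  field_simp

/-- Quasi-interpolation: the coefficient of each B-spline is the polar form of the Taylor
polynomial of `f` at the left end of the support of that spline. -/
theorem exists_spline_approx {α K : ℝ} (hα : 0 < α) (hK : 0 ≤ K) {q J : ℕ} (hq : α ≤ q)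
    (hqJ : q ≤ J) {f : ℝ → ℝ} (hf : ContDiffOn ℝ (holderDeg α : ℕ) f (Icc 0 1))
    (hH : ∀ s ∈ Icc (0 : ℝ) 1, ∀ t ∈ Icc (0 : ℝ) 1,
      |iteratedDerivWithin (holderDeg α) f (Icc 0 1) s
        - iteratedDerivWithin (holderDeg α) f (Icc 0 1) t| ≤ K * |s - t| ^ (α - holderDeg α)) :
    ∃ c : Fin J → ℝ, ∀ t ∈ Icc (0 : ℝ) 1,
      |∑ j : Fin J, basis q J j t * c j - f t|
        ≤ (holderDeg α + 1) * K * ((q : ℝ) ^ 2) ^ α * (J : ℝ) ^ (-α) := by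
  have hkq := holderDeg_lt_of_le hα hq
  have hkα := holderDeg_lt hα
  set k := holderDeg α
  obtain ⟨n, rfl⟩ : ∃ n, q = n + 1 := ⟨q - 1, by omega⟩
  set q := n + 1
  set ξ := knot q J
  set g : ℕ → ℝ → ℝ := fun r => iteratedDerivWithin r f (Icc 0 1)
  set lam : ℕ → ℝ[X] →ₗ[ℝ] ℝ := fun j => blossom n (fun i => ξ (j + 1 + i))
  have hmono : Monotone ξ := knot_mono hqJ
  set δ : ℝ := (q : ℝ) ^ 2 / J with hδ
  have hδ0 : 0 ≤ δ := by positivity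
  refine ⟨fun j => ∑ r ∈ Finset.range (k + 1),
    g r (ξ j) / r.factorial * lam j ((X - C (ξ j)) ^ r), fun t ht => ?_⟩
  have hrep : ∀ {r}, r ≤ n → ∑ j ∈ Finset.range J, bspline ξ q j t * lam j ((X - C t) ^ r)
      = (t - t) ^ r := fun {r} hr =>
    sum_bspline_mul_blossom hmono (fun j hj => knot_of_lt hj) (fun j hj => knot_of_le hqJ hj)
      ht t hr
  have hone : ∑ j ∈ Finset.range J, bspline ξ q j t = 1 := by
    have hlam : ∀ j, lam j ((X - C t) ^ 0) = 1 := fun j => by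
      have := choose_mul_blossom n (fun i => ξ (j + 1 + i)) (-t) (Nat.zero_le n)
      have hm : (∏ i ∈ Finset.range n, (X + C (ξ (j + 1 + i) + -t))).Monic :=
        monic_prod_of_monic _ _ fun i _ => monic_X_add_C _
      have h1 := hm.coeff_natDegree
      rw [natDegree_prod_X_add_C] at h1
      simp only [Nat.choose_zero_right, Nat.cast_one, one_mul, Nat.sub_zero, pow_zero, h1] at this
      simpa [lam] using this
    have h := hrep (Nat.zero_le n)
    simp only [hlam, mul_one] at h
    simpa using h
  have hft : f t = ∑ j ∈ Finset.range J, bspline ξ q j t *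
      ∑ s ∈ Finset.range (k + 1), lam j ((X - C t) ^ s) / s.factorial * g s t := by
    simp only [Finset.mul_sum]
    rw [Finset.sum_comm, Finset.sum_eq_single 0]
    · have := hrep (Nat.zero_le n)
      simp only [pow_zero] at this
      simp only [pow_zero, Nat.factorial_zero, Nat.cast_one, div_one, ← mul_assoc,
        ← Finset.sum_mul, this, g, iteratedDerivWithin_zero, one_mul]
    · intro s hs hs0
      have := hrep (r := s) (by have := Finset.mem_range.mp hs; omega)
      rw [sub_self, zero_pow hs0] at this
      have e : ∀ j, bspline ξ q j t * (lam j ((X - C t) ^ s) / s.factorial * g s t)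
          = bspline ξ q j t * lam j ((X - C t) ^ s) * (g s t / s.factorial) := fun j => by ring
      simp only [e, ← Finset.sum_mul, this, zero_mul]
    · simp
  have hbasis : ∀ c : ℕ → ℝ, ∑ j : Fin J, basis q J j t * c j
      = ∑ j ∈ Finset.range J, bspline ξ q j t * c j := fun c =>
    Fin.sum_univ_eq_sum_range (fun j => bspline ξ q j t * c j) J
  have hbound : (k + 1) * K * ((q : ℝ) ^ 2) ^ α * (J : ℝ) ^ (-α) = (k + 1) * (K * δ ^ α) := by
    rw [hδ, Real.div_rpow (by positivity) (by positivity), Real.rpow_neg (by positivity)]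
    ring
  have hsplit : (k + 1) * (K * δ ^ α)
      = ∑ j ∈ Finset.range J, bspline ξ q j t * ((k + 1) * (K * δ ^ α)) := by
    rw [← Finset.sum_mul, hone, one_mul]
  rw [hbasis (fun j => ∑ r ∈ Finset.range (k + 1),
    g r (ξ j) / r.factorial * lam j ((X - C (ξ j)) ^ r)), hft, ← Finset.sum_sub_distrib, hbound,
    hsplit]
  refine (Finset.abs_sum_le_sum_abs _ _).trans (Finset.sum_le_sum fun j _ => ?_)
  rw [← mul_sub, abs_mul, abs_of_nonneg (bspline_nonneg hmono t q j)]
  by_cases hφ : bspline ξ q j t = 0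
  · simp [hφ]
  obtain ⟨ha, hb, -⟩ := bspline_support hmono hφ
  -- The bound is local: only splines whose support contains `t` occur, so `t`, the expansion
  -- point `ξ j` and the interior knots of the spline lie within `δ` of each other.
  have hlen : ξ (j + q) - ξ j ≤ δ := knot_add_sub_le (Nat.succ_pos n) hqJ j
  have hτ : ξ j ∈ Icc (0 : ℝ) 1 := knot_mem_Icc (Nat.succ_pos n) hqJ j
  refine mul_le_mul_of_nonneg_left ?_ (bspline_nonneg hmono t q j)
  rw [sum_blossom_eq n k _ (fun r => g r (ξ j)) (ξ j) t, ← Finset.sum_sub_distrib]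
  refine (Finset.abs_sum_le_sum_abs _ _).trans ?_
  have hterm : ∀ s ∈ Finset.range (k + 1),
      |lam j ((X - C t) ^ s) / s.factorial *
          ∑ u ∈ Finset.range (k - s + 1), g (s + u) (ξ j) * (t - ξ j) ^ u / u.factorial
        - lam j ((X - C t) ^ s) / s.factorial * g s t| ≤ K * δ ^ α := by
    intro s hs
    have hs' : s ≤ k := Nat.lt_succ_iff.mp (Finset.mem_range.mp hs)
    have h1 : |lam j ((X - C t) ^ s)| ≤ δ ^ s := by
      refine abs_blossom_le hδ0 (fun i hi => ?_) (by omega)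
      have := hmono (show j ≤ j + 1 + i by omega)
      have := hmono (show j + 1 + i ≤ j + q by omega)
      rw [abs_le]
      constructor <;> linarith
    have h2 := abs_taylor_sub_le (sub_pos.mpr hkα) hK hτ (k - s) (fun r => g (s + r))
      (fun r hr y hy => hasDerivWithinAt_iteratedDerivWithin (k := k) (by omega) hf hy)
      (by rw [show s + (k - s) = k by omega]; exact hH) t ht
    have h3 : |t - ξ j| ≤ δ := by
      rw [abs_le]
      constructor <;> linarith
    have h4 : α - k + ((k - s : ℕ) : ℝ) = α - s := by
      rw [Nat.cast_sub hs']
      ring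
    have hsα : (s : ℝ) < α := (Nat.cast_le.mpr hs').trans_lt hkα
    rw [h4] at h2
    have h5 : |lam j ((X - C t) ^ s) / s.factorial| ≤ δ ^ s := by
      rw [abs_div, Nat.abs_cast]
      exact (div_le_self (abs_nonneg _) (Nat.one_le_cast.mpr s.factorial_pos)).trans h1
    rw [← mul_sub, abs_mul]
    calc _ ≤ δ ^ s * (K * δ ^ (α - s)) := by
          refine mul_le_mul h5 (h2.trans ?_) (abs_nonneg _) (by positivity)
          exact mul_le_mul_of_nonneg_left
            (Real.rpow_le_rpow (abs_nonneg _) h3 (by linarith)) hK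
      _ = K * δ ^ α := by
          rw [← Real.rpow_natCast δ s, mul_left_comm, ← Real.rpow_add' hδ0 (by linarith)]
          congr 2
          ring
  exact (Finset.sum_le_sum hterm).trans (by simp)

/-! ### Consequences of Hölder continuity of the regression map -/

theorem enorm_le_holderNorm (α : ℝ) (f : ℝ → ℝ) {t : ℝ} (ht : t ∈ Icc (0 : ℝ) 1) :
    ‖f t‖ₑ ≤ holderNorm α f := by
  calc ‖f t‖ₑ = ‖iteratedDerivWithin 0 f (Icc 0 1) t‖ₑ := by simp
    _ ≤ ⨆ t ∈ Icc (0 : ℝ) 1, ‖iteratedDerivWithin 0 f (Icc 0 1) t‖ₑ :=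
        le_iSup₂_of_le t ht le_rfl
    _ ≤ ∑ j ∈ Finset.range (holderDeg α + 1),
          ⨆ t ∈ Icc (0 : ℝ) 1, ‖iteratedDerivWithin j f (Icc 0 1) t‖ₑ :=
        Finset.single_le_sum
          (f := fun j => ⨆ t ∈ Icc (0 : ℝ) 1, ‖iteratedDerivWithin j f (Icc 0 1) t‖ₑ)
          (fun _ _ => zero_le) (by simp)
    _ ≤ _ := le_self_add

theorem abs_le_of_holderNorm_le {α K : ℝ} (hK : 0 ≤ K) {f : ℝ → ℝ}
    (h : holderNorm α f ≤ ENNReal.ofReal K) {t : ℝ} (ht : t ∈ Icc (0 : ℝ) 1) : |f t| ≤ K := by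
  have := (enorm_le_holderNorm α f ht).trans h
  rwa [Real.enorm_eq_ofReal_abs, ENNReal.ofReal_le_ofReal_iff hK] at this

theorem abs_iteratedDerivWithin_sub_le {α K : ℝ} (hα : 0 < α) (hK : 0 ≤ K) {f : ℝ → ℝ}
    (h : holderNorm α f ≤ ENNReal.ofReal K) :
    ∀ s ∈ Icc (0 : ℝ) 1, ∀ t ∈ Icc (0 : ℝ) 1,
      |iteratedDerivWithin (holderDeg α) f (Icc 0 1) s
        - iteratedDerivWithin (holderDeg α) f (Icc 0 1) t| ≤ K * |s - t| ^ (α - holderDeg α) := by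
  intro s hs t ht
  set G := (Icc (0 : ℝ) 1).domRestrict (iteratedDerivWithin (holderDeg α) f (Icc 0 1)) with hG
  set γ := (α - holderDeg α).toNNReal
  have hγ : (γ : ℝ) = α - holderDeg α := Real.coe_toNNReal _ (sub_pos.mpr (holderDeg_lt hα)).le
  have h1 : eHolderNorm γ G ≤ ENNReal.ofReal K := le_add_self.trans h
  have h2 : MemHolder γ G := eHolderNorm_lt_top.mp (h1.trans_lt ENNReal.ofReal_lt_top)
  have h3 := h2.holderWith.dist_le ⟨s, hs⟩ ⟨t, ht⟩
  have h4 : (nnHolderNorm γ G : ℝ) ≤ K := by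
    rw [← h2.coe_nnHolderNorm_eq_eHolderNorm, ENNReal.ofReal, ENNReal.coe_le_coe,
      Real.le_toNNReal_iff_coe_le hK] at h1
    exact h1
  rw [hγ, Subtype.dist_eq, Real.dist_eq, Real.dist_eq] at h3
  exact h3.trans (mul_le_mul_of_nonneg_right h4 (by positivity))

/-- The functions `Ξ x`, `x` in the cube, have Hölder seminorms bounded uniformly in `x`. -/
theorem MemHC.exists_uniform_holder {p : ℕ} {α β : ℝ} (hα : 0 < α) (hβ : 0 < β)
    {Ξ : EuclideanSpace ℝ (Fin p) → ℝ → ℝ} (h : MemHC α β Ξ) :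
    ∃ K : ℝ, 0 ≤ K ∧ ∀ x ∈ cube p, ∀ s ∈ Icc (0 : ℝ) 1, ∀ t ∈ Icc (0 : ℝ) 1,
      |iteratedDerivWithin (holderDeg α) (Ξ x) (Icc 0 1) s
        - iteratedDerivWithin (holderDeg α) (Ξ x) (Icc 0 1) t|
          ≤ K * |s - t| ^ (α - holderDeg α) := by
  obtain ⟨hC, H, hH⟩ := h
  have h0 : (0 : EuclideanSpace ℝ (Fin p)) ∈ cube p := fun j => by simp
  have hK₀ := (hC 0 h0).2
  have hcube : ∀ x ∈ cube p, ‖x‖ ≤ Real.sqrt p := by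
    intro x hx
    rw [EuclideanSpace.norm_eq]
    refine Real.sqrt_le_sqrt ?_
    refine (Finset.sum_le_sum fun j _ => ?_).trans (by simp : ∑ _j : Fin p, (1 : ℝ) ≤ p)
    rw [Real.norm_eq_abs, sq_abs]
    exact pow_le_one₀ (hx j).1 (hx j).2
  refine ⟨(holderNorm α (Ξ 0)).toReal + |H| * Real.sqrt p ^ β, by positivity, ?_⟩
  intro x hx s hs t ht
  have hd : holderNorm α (fun t => Ξ x t - Ξ 0 t) ≤ ENNReal.ofReal (|H| * Real.sqrt p ^ β) := by
    refine (hH x hx 0 h0).trans (ENNReal.ofReal_le_ofReal ?_)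
    rw [sub_zero]
    exact mul_le_mul (le_abs_self H)
      (Real.rpow_le_rpow (norm_nonneg x) (hcube x hx) hβ.le) (by positivity) (abs_nonneg H)
  have h1 := abs_iteratedDerivWithin_sub_le hα (by positivity) hd s hs t ht
  have h2 := abs_iteratedDerivWithin_sub_le hα ENNReal.toReal_nonneg
    (ENNReal.ofReal_toReal hK₀.ne).ge s hs t ht
  have hsub : ∀ y ∈ Icc (0 : ℝ) 1,
      iteratedDerivWithin (holderDeg α) (fun t => Ξ x t - Ξ 0 t) (Icc 0 1) y
        = iteratedDerivWithin (holderDeg α) (Ξ x) (Icc 0 1) y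
          - iteratedDerivWithin (holderDeg α) (Ξ 0) (Icc 0 1) y := fun y hy =>
    iteratedDerivWithin_sub hy (uniqueDiffOn_Icc zero_lt_one) ((hC x hx).1 y hy)
      ((hC 0 h0).1 y hy)
  rw [hsub s hs, hsub t ht] at h1
  rw [add_mul, add_comm]
  refine le_trans (le_of_eq_of_le ?_ (abs_add_le _ _)) (add_le_add h1 h2)
  congr 1
  ring

end Splines

/-! ### Cells of decision trees -/

namespace DTree

variable {p : ℕ}

theorem cell_subset_cube : ∀ (T : DTree p) (ℓ : T.Leaf), T.cell ℓ ⊆ cube p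
  | .leaf, _ => subset_rfl
  | .node _ _ l _, .inl ℓ => inter_subset_right.trans (cell_subset_cube l ℓ)
  | .node _ _ _ r, .inr ℓ => inter_subset_right.trans (cell_subset_cube r ℓ)

theorem exists_mem_cell {x : EuclideanSpace ℝ (Fin p)} (hx : x ∈ cube p) :
    ∀ T : DTree p, ∃ ℓ : T.Leaf, x ∈ T.cell ℓ
  | .leaf => ⟨(), hx⟩
  | .node j z l r => by
      rcases le_or_gt (x j) z with h | h
      · obtain ⟨ℓ, hℓ⟩ := exists_mem_cell hx l
        exact ⟨.inl ℓ, h, hℓ⟩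
      · obtain ⟨ℓ, hℓ⟩ := exists_mem_cell hx r
        exact ⟨.inr ℓ, h, hℓ⟩

theorem cell_unique {x : EuclideanSpace ℝ (Fin p)} :
    ∀ (T : DTree p) {ℓ ℓ' : T.Leaf}, x ∈ T.cell ℓ → x ∈ T.cell ℓ' → ℓ = ℓ'
  | .leaf, _, _, _, _ => rfl
  | .node _ _ l _, .inl _, .inl _, h, h' => congrArg Sum.inl (cell_unique l h.2 h'.2)
  | .node _ _ _ r, .inr _, .inr _, h, h' => congrArg Sum.inr (cell_unique r h.2 h'.2)
  | .node j z _ _, .inl _, .inr _, h, h' => absurd (show x j ≤ z from h.1) (not_le.mpr h'.1)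
  | .node j z _ _, .inr _, .inl _, h, h' => absurd (show x j ≤ z from h'.1) (not_le.mpr h.1)

theorem sum_leaf_node {R : Type*} [AddCommMonoid R] {j : Fin p} {z : ℝ} {l r : DTree p}
    (F : (DTree.node j z l r).Leaf → R) :
    ∑ ℓ, F ℓ = ∑ ℓ : l.Leaf, F (.inl ℓ) + ∑ ℓ : r.Leaf, F (.inr ℓ) :=
  Fintype.sum_sum_type F

end DTree

theorem treeMap_eq_of_mem {p : ℕ} (q J : ℕ) (T : DTree p) (μ : T.Leaf → Fin J → ℝ)
    {x : EuclideanSpace ℝ (Fin p)} {ℓ : T.Leaf} (h : x ∈ T.cell ℓ) (t : ℝ) :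
    treeMap q J T μ x t = ∑ j : Fin J, basis q J j t * μ ℓ j := by
  rw [treeMap, Finset.sum_eq_single ℓ]
  · exact indicator_of_mem h _
  · intro ℓ' _ hne
    exact indicator_of_notMem (fun h' => hne (T.cell_unique h' h)) _
  · simp

/-! ### Diameters of the cells of a k-d tree -/

section KD

variable {p n : ℕ} (x : Fin n → EuclideanSpace ℝ (Fin p)) (var : ℕ → Fin p)

theorem IsKDFrom.card_leaf : ∀ {T : DTree p} {A : Finset (Fin n)} {k d : ℕ},
    IsKDFrom x var T A k d → Fintype.card T.Leaf = 2 ^ d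
  | .leaf, _, _, d, h => by
      obtain rfl : d = 0 := h
      rfl
  | .node _ _ _ _, _, _, 0, h => h.elim
  | .node _ _ l r, _, _, d + 1, h => by
      rw [pow_succ, mul_two]
      nth_rewrite 1 [← IsKDFrom.card_leaf h.2.2.1]
      rw [← IsKDFrom.card_leaf h.2.2.2]
      exact Fintype.card_sum

/-- Cutting a k-d tree off at depth `e` gives a k-d tree with coarser cells. -/
theorem IsKDFrom.exists_truncation : ∀ {T : DTree p} {A : Finset (Fin n)} {k d e : ℕ},
    IsKDFrom x var T A k d → e ≤ d →
      ∃ T' : DTree p, IsKDFrom x var T' A k e ∧ ∀ ℓ, ∃ ℓ', T.cell ℓ ⊆ T'.cell ℓ'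
  | T, _, _, _, 0, _, _ => ⟨.leaf, rfl, fun ℓ => ⟨(), T.cell_subset_cube ℓ⟩⟩
  | .leaf, _, _, d, e + 1, h, he => by
      obtain rfl : d = 0 := h
      omega
  | .node _ _ _ _, _, _, 0, _ + 1, h, _ => h.elim
  | .node j z l r, A, k, d + 1, e + 1, h, he => by
      obtain ⟨hj, hm, hl, hr⟩ := h
      obtain ⟨l', hl', cl⟩ := IsKDFrom.exists_truncation hl (Nat.le_of_succ_le_succ he)
      obtain ⟨r', hr', cr⟩ := IsKDFrom.exists_truncation hr (Nat.le_of_succ_le_succ he)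
      refine ⟨.node j z l' r', ⟨hj, hm, hl', hr'⟩, ?_⟩
      rintro (ℓ | ℓ)
      · obtain ⟨ℓ', h'⟩ := cl ℓ
        exact ⟨.inl ℓ', inter_subset_inter_right _ h'⟩
      · obtain ⟨ℓ', h'⟩ := cr ℓ
        exact ⟨.inr ℓ', inter_subset_inter_right _ h'⟩

open Classical in
/-- The observations of `A` whose design point lies in the cell of a terminal node. -/
noncomputable def cellObs (A : Finset (Fin n)) (T : DTree p) (ℓ : T.Leaf) : Finset (Fin n) :=
  A.filter fun i => x i ∈ T.cell ℓ

theorem mem_cellObs {A : Finset (Fin n)} {T : DTree p} {ℓ : T.Leaf} {i : Fin n} :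
    i ∈ cellObs x A T ℓ ↔ i ∈ A ∧ x i ∈ T.cell ℓ := by
  simp [cellObs]

theorem cellObs_subset (A : Finset (Fin n)) (T : DTree p) (ℓ : T.Leaf) :
    cellObs x A T ℓ ⊆ A := fun _ h => ((mem_cellObs x).mp h).1

theorem cellObs_inl (A : Finset (Fin n)) {j : Fin p} {z : ℝ} {l r : DTree p} (ℓ : l.Leaf) :
    cellObs x A (.node j z l r) (.inl ℓ) = cellObs x (A.filter fun i => x i j ≤ z) l ℓ := by
  ext i
  refine (mem_cellObs x).trans (Iff.trans ?_ (mem_cellObs x).symm)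
  rw [Finset.mem_filter, and_assoc]
  rfl

theorem cellObs_inr (A : Finset (Fin n)) {j : Fin p} {z : ℝ} {l r : DTree p} (ℓ : r.Leaf) :
    cellObs x A (.node j z l r) (.inr ℓ) = cellObs x (A.filter fun i => z < x i j) r ℓ := by
  ext i
  refine (mem_cellObs x).trans (Iff.trans ?_ (mem_cellObs x).symm)
  rw [Finset.mem_filter, and_assoc]
  rfl

/-- Since every split halves the observations, up to rounding up, a bound `N * 2 ^ d` at the root
gives the bound `N` at the terminal nodes. -/
theorem IsKDFrom.card_cellObs_le {N : ℕ} : ∀ {T : DTree p} {A : Finset (Fin n)} {k d : ℕ},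
    IsKDFrom x var T A k d → A.card ≤ N * 2 ^ d → ∀ ℓ, (cellObs x A T ℓ).card ≤ N
  | .leaf, A, _, d, h, hA, ℓ => by
      obtain rfl : d = 0 := h
      exact (Finset.card_le_card (cellObs_subset x A _ ℓ)).trans (by simpa using hA)
  | .node _ _ _ _, _, _, 0, h, _, _ => h.elim
  | .node j z l r, A, k, d + 1, h, hA, ℓ => by
      obtain ⟨hj, hm, hl, hr⟩ := h
      rcases A.eq_empty_or_nonempty with rfl | hne
      · have := Finset.card_le_card (cellObs_subset x ∅ (.node j z l r) ℓ)
        simp only [Finset.card_empty] at this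
        omega
      have hcard := (hm hne).2
      have hsplit := Finset.card_filter_add_card_filter_not (s := A) (fun i => x i j ≤ z)
      simp only [not_le] at hsplit
      rw [pow_succ, ← mul_assoc] at hA
      rcases ℓ with ℓ | ℓ
      · rw [cellObs_inl]
        exact IsKDFrom.card_cellObs_le hl (by omega) ℓ
      · rw [cellObs_inr]
        exact IsKDFrom.card_cellObs_le hr (by omega) ℓ

/-- The width along the `j`-th variable of the set of design points with index in `A`. -/
noncomputable def width (j : Fin p) (A : Finset (Fin n)) : ℝ :=
  Metric.diam ((fun i => x i j) '' (A : Set (Fin n)))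

theorem isBounded_image (f : Fin n → ℝ) (A : Finset (Fin n)) :
    Bornology.IsBounded (f '' (A : Set (Fin n))) :=
  ((A.finite_toSet).image f).isBounded

theorem width_nonneg (j : Fin p) (A : Finset (Fin n)) : 0 ≤ width x j A := Metric.diam_nonneg

theorem width_mono (j : Fin p) {A B : Finset (Fin n)} (h : A ⊆ B) :
    width x j A ≤ width x j B :=
  Metric.diam_mono (image_mono (Finset.coe_subset.mpr h)) (isBounded_image _ _)

theorem abs_sub_le_width (j : Fin p) {A : Finset (Fin n)} {i i' : Fin n} (hi : i ∈ A)
    (hi' : i' ∈ A) : |x i j - x i' j| ≤ width x j A := by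
  rw [← Real.dist_eq]
  exact Metric.dist_le_diam_of_mem (isBounded_image _ _) (mem_image_of_mem _ hi)
    (mem_image_of_mem _ hi')

theorem exists_width_eq (j : Fin p) {A : Finset (Fin n)} (hA : A.Nonempty) :
    ∃ i ∈ A, ∃ i' ∈ A, width x j A = x i' j - x i j := by
  obtain ⟨a, ha, hmin⟩ := A.exists_min_image (fun i => x i j) hA
  obtain ⟨b, hb, hmax⟩ := A.exists_max_image (fun i => x i j) hA
  refine ⟨a, ha, b, hb, le_antisymm ?_ ((le_abs_self _).trans (abs_sub_le_width x j hb ha))⟩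
  refine Metric.diam_le_of_forall_dist_le (sub_nonneg.mpr (hmin b hb)) ?_
  rintro _ ⟨i, hi, rfl⟩ _ ⟨i', hi', rfl⟩
  have := hmin i hi
  have := hmin i' hi'
  have := hmax i hi
  have := hmax i' hi'
  rw [Real.dist_eq, abs_le]
  constructor <;> linarith

/-- A split along the `j`-th variable does not increase the total width along it. -/
theorem width_filter_add_le (j : Fin p) (z : ℝ) (A : Finset (Fin n)) :
    width x j (A.filter fun i => x i j ≤ z) + width x j (A.filter fun i => z < x i j)
      ≤ width x j A := by
  have h0 : width x j ∅ = 0 := by simp [width]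
  rcases (A.filter fun i => x i j ≤ z).eq_empty_or_nonempty with hl | hl
  · rw [hl, h0, zero_add]
    exact width_mono x j (Finset.filter_subset _ _)
  rcases (A.filter fun i => z < x i j).eq_empty_or_nonempty with hr | hr
  · rw [hr, h0, add_zero]
    exact width_mono x j (Finset.filter_subset _ _)
  obtain ⟨a, ha, b, hb, hab⟩ := exists_width_eq x j hl
  obtain ⟨c, hc, e, he, hce⟩ := exists_width_eq x j hr
  have h := abs_sub_le_width x j (Finset.mem_of_mem_filter e he) (Finset.mem_of_mem_filter a ha)
  have hbz := (Finset.mem_filter.mp hb).2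
  have hcz := (Finset.mem_filter.mp hc).2
  have := le_abs_self (x e j - x a j)
  rw [hab, hce]
  linarith

/-- Only the splits along the other variables can double the total width along the `j`-th one. -/
theorem IsKDFrom.sum_width_le (j : Fin p) : ∀ {T : DTree p} {A : Finset (Fin n)} {k d : ℕ},
    IsKDFrom x var T A k d → ∑ ℓ, width x j (cellObs x A T ℓ)
      ≤ (∏ i ∈ Finset.range d, if var (k + i) = j then (1 : ℝ) else 2) * width x j A
  | .leaf, A, _, d, h => by
      obtain rfl : d = 0 := h
      have : ∑ ℓ : (DTree.leaf : DTree p).Leaf, width x j (cellObs x A .leaf ℓ)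
          = width x j (cellObs x A .leaf ()) := Fintype.sum_unique (ι := Unit) _
      rw [this]
      simpa using width_mono x j (cellObs_subset x A _ _)
  | .node _ _ _ _, _, _, 0, h => h.elim
  | .node j' z l r, A, k, d + 1, h => by
      obtain ⟨hj, hm, hl, hr⟩ := h
      rw [DTree.sum_leaf_node]
      simp only [cellObs_inl, cellObs_inr]
      have h1 := IsKDFrom.sum_width_le j hl
      have h2 := IsKDFrom.sum_width_le j hr
      set P : ℝ := ∏ i ∈ Finset.range d, if var (k + 1 + i) = j then (1 : ℝ) else 2
      have e : ∏ i ∈ Finset.range d, (if var (k + (i + 1)) = j then (1 : ℝ) else 2) = P :=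
        Finset.prod_congr rfl fun i _ => by rw [show k + (i + 1) = k + 1 + i by omega]
      rw [Finset.prod_range_succ', e, add_zero]
      have hP0 : 0 ≤ P := Finset.prod_nonneg fun i _ => by split_ifs <;> norm_num
      refine (add_le_add h1 h2).trans ?_
      rw [← mul_add, mul_assoc]
      refine mul_le_mul_of_nonneg_left ?_ hP0
      split_ifs with hv
      · rw [one_mul]
        obtain rfl : j' = j := hj.trans hv
        exact width_filter_add_le x j' z A
      · rw [two_mul]
        exact add_le_add (width_mono x j (Finset.filter_subset _ _))
          (width_mono x j (Finset.filter_subset _ _))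

end KD

/-- In `s` rounds of splitting cycles all variables but the `j`-th one are split `s` times each. -/
theorem prod_cycle {p : ℕ} [NeZero p] (σ : Equiv.Perm (Fin p)) (j : Fin p) (s : ℕ) :
    ∏ i ∈ Finset.range (s * p), (if σ (Fin.ofNat p (0 + i)) = j then (1 : ℝ) else 2)
      = (2 ^ (p - 1)) ^ s := by
  have hcycle : ∀ s : ℕ, ∏ i ∈ Finset.range p,
      (if σ (Fin.ofNat p (0 + (s * p + i))) = j then (1 : ℝ) else 2) = 2 ^ (p - 1) := by
    intro s
    rw [Finset.prod_range]
    have e : ∀ i : Fin p, Fin.ofNat p (0 + (s * p + i)) = i := fun i => by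
      ext
      simp [Nat.mod_eq_of_lt i.2]
    simp only [e]
    rw [Equiv.prod_comp σ (fun i => if i = j then (1 : ℝ) else 2),
      ← Finset.mul_prod_erase _ _ (Finset.mem_univ j), if_pos rfl, one_mul,
      Finset.prod_congr rfl fun i hi => if_neg (Finset.ne_of_mem_erase hi)]
    simp
  induction s with
  | zero => simp
  | succ s ih => rw [add_mul, one_mul, Finset.prod_range_add, ih, hcycle, pow_succ]

theorem norm_le_sum_abs {p : ℕ} (v : EuclideanSpace ℝ (Fin p)) : ‖v‖ ≤ ∑ j, |v j| := by
  rw [EuclideanSpace.norm_eq]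
  refine Real.sqrt_le_iff.mpr ⟨Finset.sum_nonneg fun _ _ => abs_nonneg _, ?_⟩
  simp only [Real.norm_eq_abs]
  exact Finset.sum_sq_le_sq_sum_of_nonneg fun _ _ => abs_nonneg _

section Design

variable {p n : ℕ} {x : Fin n → EuclideanSpace ℝ (Fin p)}

theorem isBounded_range_inter (D : Set (EuclideanSpace ℝ (Fin p))) :
    Bornology.IsBounded (range x ∩ D) :=
  ((finite_range x).subset inter_subset_left).isBounded

theorem designDiam_mono {D D' : Set (EuclideanSpace ℝ (Fin p))} (h : D ⊆ D') :
    designDiam x D ≤ designDiam x D' :=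
  Metric.diam_mono (inter_subset_inter_right _ h) (isBounded_range_inter D')

theorem norm_sub_le_designDiam {D : Set (EuclideanSpace ℝ (Fin p))} {i i' : Fin n}
    (hi : x i ∈ D) (hi' : x i' ∈ D) : ‖x i - x i'‖ ≤ designDiam x D := by
  rw [← dist_eq_norm]
  exact Metric.dist_le_diam_of_mem (isBounded_range_inter D) ⟨mem_range_self i, hi⟩
    ⟨mem_range_self i', hi'⟩

theorem designDiam_cell_le (T : DTree p) (ℓ : T.Leaf) :
    designDiam x (T.cell ℓ) ≤ ∑ j, width x j (cellObs x Finset.univ T ℓ) := by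
  refine Metric.diam_le_of_forall_dist_le (Finset.sum_nonneg fun j _ => width_nonneg x j _) ?_
  rintro _ ⟨⟨i, rfl⟩, hi⟩ _ ⟨⟨i', rfl⟩, hi'⟩
  rw [dist_eq_norm]
  refine (norm_le_sum_abs _).trans (Finset.sum_le_sum fun j _ => ?_)
  exact abs_sub_le_width x j ((mem_cellObs x).mpr ⟨Finset.mem_univ i, hi⟩)
    ((mem_cellObs x).mpr ⟨Finset.mem_univ i', hi'⟩)

theorem width_le_one (hx : ∀ i, x i ∈ cube p) (j : Fin p) (A : Finset (Fin n)) :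
    width x j A ≤ 1 := by
  refine Metric.diam_le_of_forall_dist_le zero_le_one ?_
  rintro _ ⟨i, -, rfl⟩ _ ⟨i', -, rfl⟩
  have h1 := hx i j
  have h2 := hx i' j
  rw [Real.dist_eq, abs_le]
  constructor <;> linarith [h1.1, h1.2, h2.1, h2.2]

theorem designCount_cell (T : DTree p) (ℓ : T.Leaf) :
    designCount x (T.cell ℓ) = (cellObs x Finset.univ T ℓ).card := by
  classical
  rw [designCount, Nat.card_eq_fintype_card, Fintype.card_subtype, cellObs]

theorem designDiam_eq_zero_of_card_le_one {T : DTree p} {ℓ : T.Leaf}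
    (h : (cellObs x Finset.univ T ℓ).card ≤ 1) : designDiam x (T.cell ℓ) = 0 := by
  refine Metric.diam_subsingleton ?_
  rintro _ ⟨⟨i, rfl⟩, hi⟩ _ ⟨⟨i', rfl⟩, hi'⟩
  rw [Finset.card_le_one.mp h i ((mem_cellObs x).mpr ⟨Finset.mem_univ i, hi⟩) i'
    ((mem_cellObs x).mpr ⟨Finset.mem_univ i', hi'⟩)]

/-- After `s` rounds of splits the cells of a k-d tree for a regular design have diameter of
order `2 ^ (-s)`. If `n < 2 ^ (s * p)` no cell has two observations; otherwise all counts are at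
most `2 * n / 2 ^ (s * p)`, while the total width along each variable is at most
`2 ^ (s * (p - 1))`. -/
theorem RegularDesign.designDiam_le_of_rounds [NeZero p] {M : ℝ} (hM : 0 ≤ M) (hn : 0 < n)
    (hx : ∀ i, x i ∈ cube p) {σ : Equiv.Perm (Fin p)} (hreg : RegularDesign x σ M) {s : ℕ}
    (hs : 1 ≤ s) {T : DTree p} (hT : IsKDTree x σ (s * p) T) (ℓ : T.Leaf) :
    designDiam x (T.cell ℓ) ≤ 2 * p * M * (1 / 2) ^ s := by
  have hp : 0 < p := Nat.pos_of_neZero p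
  rcases lt_or_ge n (2 ^ (s * p)) with hlt | hge
  · rw [designDiam_eq_zero_of_card_le_one
      (IsKDFrom.card_cellObs_le x _ hT (by simpa using hlt.le) ℓ)]
    positivity
  set N : ℕ := n / 2 ^ (s * p) + 1 with hN
  have hpow : 0 < 2 ^ (s * p) := by positivity
  have hN1 : n ≤ N * 2 ^ (s * p) :=
    (Nat.lt_div_mul_add hpow).le.trans (by rw [hN, add_mul, one_mul])
  have hN2 : N * 2 ^ (s * p) ≤ 2 * n := by
    have := Nat.div_mul_le_self n (2 ^ (s * p))
    rw [hN, add_mul, one_mul]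
    omega
  have hcount := IsKDFrom.card_cellObs_le x _ hT (by simpa using hN1)
  have hwidth : ∀ j, ∑ ℓ, width x j (cellObs x Finset.univ T ℓ) ≤ (2 ^ (p - 1)) ^ s := by
    intro j
    refine (IsKDFrom.sum_width_le x _ j hT).trans ?_
    rw [prod_cycle]
    exact mul_le_of_le_one_right (by positivity) (width_le_one hx j _)
  have hn' : (0 : ℝ) < n := Nat.cast_pos.mpr hn
  have hsum : ∑ ℓ', (designCount x (T.cell ℓ') : ℝ) / n * designDiam x (T.cell ℓ')
      ≤ N / n * (p * (2 ^ (p - 1)) ^ s) := by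
    calc _ ≤ ∑ ℓ', (N : ℝ) / n * ∑ j, width x j (cellObs x Finset.univ T ℓ') := by
          refine Finset.sum_le_sum fun ℓ' _ => ?_
          rw [designCount_cell]
          refine mul_le_mul ?_ (designDiam_cell_le T ℓ') Metric.diam_nonneg (by positivity)
          exact div_le_div_of_nonneg_right (Nat.cast_le.mpr (hcount ℓ')) hn'.le
      _ = N / n * ∑ j, ∑ ℓ', width x j (cellObs x Finset.univ T ℓ') := by
          rw [← Finset.mul_sum, Finset.sum_comm]
      _ ≤ _ := by
          refine mul_le_mul_of_nonneg_left ?_ (by positivity)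
          exact (Finset.sum_le_sum fun j _ => hwidth j).trans (by simp)
  have hNn : (N : ℝ) / n * (2 ^ (p - 1)) ^ s ≤ 2 * (1 / 2) ^ s := by
    have h2 : (N : ℝ) * 2 ^ (s * p) ≤ 2 * n := by exact_mod_cast hN2
    have h3 : (2 : ℝ) ^ (s * p) = (2 ^ (p - 1)) ^ s * 2 ^ s := by
      rw [← mul_pow, ← pow_succ, Nat.sub_add_cancel hp, ← pow_mul, mul_comm]
    rw [one_div, inv_pow, div_mul_eq_mul_div, div_le_iff₀ hn', mul_right_comm,
      ← div_eq_mul_inv, le_div_iff₀ (by positivity), mul_assoc, ← h3]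
    exact h2
  calc _ ≤ M * (N / n * (p * (2 ^ (p - 1)) ^ s)) :=
        (hreg s hs T hT ℓ).trans (mul_le_mul_of_nonneg_left hsum hM)
    _ = M * p * (N / n * (2 ^ (p - 1)) ^ s) := by ring
    _ ≤ M * p * (2 * (1 / 2) ^ s) := mul_le_mul_of_nonneg_left hNn (by positivity)
    _ = _ := by ring

/-- For a tree of depth `d` the cells are compared with those of its truncation to the largest
multiple of `p` that is at most `d`, which costs a factor of two at most. -/
theorem RegularDesign.designDiam_le [NeZero p] {M : ℝ} (hM : 0 ≤ M) (hn : 0 < n)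
    (hx : ∀ i, x i ∈ cube p) {σ : Equiv.Perm (Fin p)} (hreg : RegularDesign x σ M) {d : ℕ}
    {T : DTree p} (hT : IsKDTree x σ d T) (ℓ : T.Leaf) :
    designDiam x (T.cell ℓ)
      ≤ 2 * p * (2 * M + 1) * (Fintype.card T.Leaf : ℝ) ^ (-1 / (p : ℝ)) := by
  have hp : 0 < p := Nat.pos_of_neZero p
  have hp' : (0 : ℝ) < p := Nat.cast_pos.mpr hp
  set s := d / p with hs
  have h1 : designDiam x (T.cell ℓ) ≤ p * (2 * M + 1) * (1 / 2) ^ s := by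
    rcases Nat.eq_zero_or_pos s with h0 | hpos
    · -- Regularity says nothing about trees of depth less than `p`.
      refine (designDiam_cell_le T ℓ).trans
        ((Finset.sum_le_sum fun j _ => width_le_one hx j _).trans ?_)
      rw [h0]
      simp
      nlinarith
    · obtain ⟨T', hT', hsub⟩ := IsKDFrom.exists_truncation x _ hT (Nat.div_mul_le_self d p)
      obtain ⟨ℓ', hℓ'⟩ := hsub ℓ
      refine (designDiam_mono hℓ').trans
        ((hreg.designDiam_le_of_rounds hM hn hx hpos hT' ℓ').trans ?_)
      exact mul_le_mul_of_nonneg_right (by linarith) (by positivity)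
  have h2 : ((1 : ℝ) / 2) ^ s ≤ 2 * (Fintype.card T.Leaf : ℝ) ^ (-1 / (p : ℝ)) := by
    rw [IsKDFrom.card_leaf x _ hT]
    have hd : (d : ℝ) < (s + 1) * p := by
      have := Nat.lt_div_mul_add (a := d) hp
      rw [← hs] at this
      rw [add_mul, one_mul]
      exact_mod_cast this
    have h3 : (d : ℝ) / p < s + 1 := (div_lt_iff₀ hp').mpr hd
    push_cast
    rw [← Real.rpow_natCast 2 d, ← Real.rpow_mul (by norm_num), one_div, inv_pow,
      ← Real.rpow_natCast 2 s, ← Real.rpow_neg (by norm_num)]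
    nth_rewrite 2 [← Real.rpow_one 2]
    rw [← Real.rpow_add (by norm_num)]
    refine Real.rpow_le_rpow_of_exponent_le (by norm_num) ?_
    rw [mul_div_assoc', mul_neg_one, neg_div]
    linarith
  refine h1.trans ?_
  calc _ ≤ p * (2 * M + 1) * (2 * (Fintype.card T.Leaf : ℝ) ^ (-1 / (p : ℝ))) :=
        mul_le_mul_of_nonneg_left h2 (by positivity)
    _ = _ := by ring

end Design

/-! ### The empirical distance and the approximating tree map -/

theorem empDist_le {p n : ℕ} (hn : 0 < n) {x : Fin n → EuclideanSpace ℝ (Fin p)} {m : Fin n → ℕ}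
    (hm : ∀ i, 0 < m i) {t : (i : Fin n) → Fin (m i) → ℝ}
    {Ξ Ξ' : EuclideanSpace ℝ (Fin p) → ℝ → ℝ} {E : ℝ} (hE : 0 ≤ E)
    (h : ∀ i j, |Ξ (x i) (t i j) - Ξ' (x i) (t i j)| ≤ E) : empDist x m t Ξ Ξ' ≤ E := by
  have hpos : (0 : ℝ) < ((∑ i, m i : ℕ) : ℝ) :=
    Nat.cast_pos.mpr (Finset.sum_pos (fun i _ => hm i) ⟨⟨0, hn⟩, Finset.mem_univ _⟩)
  refine Real.sqrt_le_iff.mpr ⟨hE, (div_le_iff₀ hpos).mpr ?_⟩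
  calc _ ≤ ∑ i, ∑ _j : Fin (m i), E ^ 2 :=
        Finset.sum_le_sum fun i _ => Finset.sum_le_sum fun j _ =>
          sq_le_sq' (abs_le.mp (h i j)).1 (abs_le.mp (h i j)).2
    _ = _ := by simp [← Finset.sum_mul, mul_comm]

end FBART

theorem lemma3 {p : ℕ} [NeZero p] (α β M : ℝ) (hα : 0 < α) (hβ : 0 < β) (hβ' : β ≤ 1) (hM : 0 < M)
    (q : ℕ) (hq : α ≤ (q : ℝ)) (Ξ₀ : EuclideanSpace ℝ (Fin p) → ℝ → ℝ)
    (hΞ₀ : FBART.MemHC α β Ξ₀) :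
    ∃ C : ℝ, 0 < C ∧
      ∀ (n : ℕ) (_ : 0 < n) (x : Fin n → EuclideanSpace ℝ (Fin p)) (_ : ∀ i, x i ∈ FBART.cube p)
        (m : Fin n → ℕ) (_ : ∀ i, 0 < m i) (t : (i : Fin n) → Fin (m i) → ℝ)
        (_ : ∀ i j, t i j ∈ Set.Icc (0 : ℝ) 1)
        (σ : Equiv.Perm (Fin p)) (_ : FBART.RegularDesign x σ M)
        (J : ℕ) (_ : q ≤ J)
        (d : ℕ) (T : FBART.DTree p) (_ : FBART.IsKDTree x σ d T),
        ∃ μ : T.Leaf → Fin J → ℝ,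
          FBART.empDist x m t (FBART.treeMap q J T μ) Ξ₀ ≤
            C * ((J : ℝ) ^ (-α) + (Fintype.card T.Leaf : ℝ) ^ (-β / (p : ℝ))) := by
  open FBART in
  obtain ⟨K, hK, hKΞ⟩ := hΞ₀.exists_uniform_holder hα hβ
  obtain ⟨hC, H, hH⟩ := hΞ₀
  set C₁ : ℝ := (holderDeg α + 1) * K * ((q : ℝ) ^ 2) ^ α with hC₁
  set C₂ : ℝ := |H| * (2 * p * (2 * M + 1)) ^ β with hC₂
  have hC₁0 : 0 ≤ C₁ := by positivity
  have hC₂0 : 0 ≤ C₂ := by positivity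
  refine ⟨C₁ + C₂ + 1, by positivity, ?_⟩
  intro n hn x hx m hm t ht σ hreg J hJ d T hT
  have hleaf : ∀ ℓ : T.Leaf, ∃ c : Fin J → ℝ, ∀ i, x i ∈ T.cell ℓ → ∀ s ∈ Set.Icc (0 : ℝ) 1,
      |∑ j : Fin J, basis q J j s * c j - Ξ₀ (x i) s|
        ≤ C₁ * (J : ℝ) ^ (-α) + C₂ * (Fintype.card T.Leaf : ℝ) ^ (-β / (p : ℝ)) := by
    intro ℓ
    -- The node parameters approximate `Ξ₀` at one of the design points in the cell.
    by_cases hex : ∃ i₀, x i₀ ∈ T.cell ℓ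
    swap
    · exact ⟨0, fun i hi => absurd ⟨i, hi⟩ hex⟩
    obtain ⟨i₀, hi₀⟩ := hex
    obtain ⟨c, hc⟩ := exists_spline_approx hα hK hq hJ (hC _ (hx i₀)).1 (hKΞ _ (hx i₀))
    refine ⟨c, fun i hi s hs => ?_⟩
    have h1 : |Ξ₀ (x i₀) s - Ξ₀ (x i) s| ≤ |H| * ‖x i₀ - x i‖ ^ β :=
      abs_le_of_holderNorm_le (α := α) (by positivity)
        ((hH _ (hx i₀) _ (hx i)).trans (ENNReal.ofReal_le_ofReal
          (mul_le_mul_of_nonneg_right (le_abs_self H) (by positivity)))) hs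
    have h2 : ‖x i₀ - x i‖ ≤ 2 * p * (2 * M + 1) * (Fintype.card T.Leaf : ℝ) ^ (-1 / (p : ℝ)) :=
      (norm_sub_le_designDiam hi₀ hi).trans (hreg.designDiam_le hM.le hn hx hT ℓ)
    have h3 : |H| * ‖x i₀ - x i‖ ^ β ≤ C₂ * (Fintype.card T.Leaf : ℝ) ^ (-β / (p : ℝ)) := by
      refine (mul_le_mul_of_nonneg_left (Real.rpow_le_rpow (norm_nonneg _) h2 hβ.le)
        (abs_nonneg H)).trans (le_of_eq ?_)
      rw [Real.mul_rpow (by positivity) (by positivity), ← Real.rpow_mul (by positivity), hC₂,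
        show -1 / (p : ℝ) * β = -β / p by ring, ← mul_assoc]
    exact (abs_sub_le _ _ _).trans (add_le_add (hc s hs) (h1.trans h3))
  choose μ hμ using hleaf
  refine ⟨μ, ?_⟩
  have hJ0 : 0 ≤ (J : ℝ) ^ (-α) := by positivity
  have hL0 : 0 ≤ (Fintype.card T.Leaf : ℝ) ^ (-β / (p : ℝ)) := by positivity
  refine empDist_le hn hm (by positivity) fun i j => ?_
  obtain ⟨ℓ, hℓ⟩ := DTree.exists_mem_cell (hx i) T
  rw [treeMap_eq_of_mem q J T μ hℓ]
  refine (hμ ℓ i hℓ _ (ht i j)).trans ?_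
  nlinarith [mul_nonneg hC₁0 hL0, mul_nonneg hC₂0 hJ0]
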